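/- Fix a square root $i$ of $-1$. Let $V=V_0\oplus V_1$ be a finite dimensional real super vector space with a symplectic form $B=B_0\oplus B_1$ ($B_0$ a non-degenerate alternating form on $V_0$, $B_1$ a non-degenerate symmetric form on $V_1$), $m=\dim V_0$, $n=\dim V_1$. Fix a symplectic basis of $V_0$, with dual coordinates $x^1,\dots,x^m$, and an orthonormal basis $f_1,\dots,f_n$ of $V_1\otimes\mathbb C$ with each $f_j\in V_1\cup iV_1$ (this orients $V_1$), with dual odd coordinates $\xi^1,\dots,\xi^n$. Let $d_V=(2\pi)^{-m/2}|dx^1\cdots dx^m|\,\frac{\partial}{\partial\xi^1}\cdots\frac{\partial}{\partial\xi^n}$ be the corresponding Liouville (Berezin) integral on $V$. Let $\mathfrak{spo}(V)$ be the orthosymplectic Lie superalgebra of $(V,B)$; its even part is $\mathfrak{spo}(V)_0=\mathfrak{sp}(V_0)\oplus\mathfrak{so}(V_1)$. The superPfaffian is the generalized function on the supermanifold $\mathfrak{spo}(V)$, that is, the generalized function on $\mathfrak{spo}(V)_0$ with values in $\Lambda(\mathfrak{spo}(V)_1^*)\otimes\mathbb C$, defined for every smooth compactly supported distribution $t$ on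 $\mathfrak{spo}(V)_0$ by $$\int t(X)\,\mathrm{Spf}(X)=i^{\frac{m-n}{2}}\int_V d_V(v)\int t(X)\exp\Big(-\frac i2B\big(v,(X+\Xi)v\big)\Big),$$ where $v$ is the generic point of $V$ and $\Xi$ the generic point of the odd part $\mathfrak{spo}(V)_1$: the integral over $X\in\mathfrak{spo}(V)_0$ is evaluated first, and then the one over $V$. (If $n$ is odd the integral vanishes, so that the choice of the power $i^{(m-n)/2}$ does not matter.) Let $\widetilde\mu:V_0\to\mathfrak{spo}(V)_0^*$, $\widetilde\mu(v)(X)=-\frac12B(v,Xv)$, be the moment map. Fix a norm on $\mathfrak{spo}(V)_0$ and let $N$ be the dual norm on $\mathfrak{spo}(V)_0^*$. For a smooth compactly supported distribution $\phi$ on $\mathfrak{spo}(V)_0$, with smooth density again written $\phi$, put $\widehat{\phi\,\mathrm{Spf}}(h)=\int\phi(X)\,\mathrm{Spf}(X)\,e^{-ih(X)}$ for $h\in\mathfrak{spo}(V)_0^*$. Let $\Sigma(\phi\,\mathrm{Spf})$ be the set of all $f\ne0$ in $\mathfrak{spo}(V)_0^*$ that have no open conic neighbourhood $\Gamma$ on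 which $\widehat{\phi\,\mathrm{Spf}}$ is rapidly decreasing, where rapidly decreasing on $\Gamma$ means that for every component of $\widehat{\phi\,\mathrm{Spf}}$ in $\Lambda(\mathfrak{spo}(V)_1^*)\otimes\mathbb C$ and every $k\in\mathbb N$ there is a constant $C$ with absolute value of the component at $h$ at most $C(1+N(h))^{-k}$ for all $h\in\Gamma$. For $X\in\mathfrak{spo}(V)_0$ the wave front set of $\mathrm{Spf}$ at $X$ is $$WF_X(\mathrm{Spf})=\bigcap_{\phi,\ \phi(X)\neq0}\Sigma(\phi\,\mathrm{Spf}).$$ **Proposition.** For every smooth compactly supported distribution $t$ on $\mathfrak{spo}(V)_0$ the integral over $V$ defining $\int t(X)\,\mathrm{Spf}(X)$ converges absolutely (after the integral over $X$ and the odd variables has been carried out), and for every $X\in\mathfrak{spo}(V)_0$, in particular at every singular point $X$ of $\mathrm{Spf}$, $$WF_X(\mathrm{Spf})\subset\widetilde\mu(V_0)\setminus\{0\}.$$ -/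

import Mathlib

open MeasureTheory
open scoped ContDiff

noncomputable section

namespace SuperPfaffian

/-! ### Wave front sets of finite-dimensionally valued generalized functions

`E` is a finite dimensional real vector space with a fixed Lebesgue measure, so that smooth
compactly supported distributions on `E` are identified with their densities. A generalized
function with values in a finite dimensional complex vector space `W` is recorded through its
components `u t ℓ = ℓ (u(t))`, for a test density `t` and a linear form `ℓ` on `W`. -/

section WaveFront

variable {E : Type*} [NormedAddCommGroup E] [NormedSpace ℝ E]

/-- Smooth compactly supported complex valued (densities of) test distributions. -/
structure IsTest (φ : E → ℂ) : Prop where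
  smooth : ContDiff ℝ ∞ φ
  compact : HasCompactSupport φ

/-- An open conic neighbourhood of `f`. -/
structure IsConicNhd (Γ : Set (E →L[ℝ] ℝ)) (f : E →L[ℝ] ℝ) : Prop where
  isOpen : IsOpen Γ
  mem : f ∈ Γ
  cone : ∀ h ∈ Γ, ∀ s : ℝ, 0 < s → s • h ∈ Γ

/-- The Fourier transform at `h` of `φ u`, that is `∫ φ(X) u(X) exp(-i h(X))`, componentwise.
`ii` is the chosen square root of `-1`. -/
def fourierLoc {L : Type*} (ii : ℂ) (u : (E → ℂ) → L → ℂ) (φ : E → ℂ)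
    (h : E →L[ℝ] ℝ) (ℓ : L) : ℂ :=
  u (fun X => φ X * Complex.exp (-ii * (h X : ℂ))) ℓ

/-- The cone `Σ` attached to a Fourier transform `F`: `f ∉ Σ` if and only if `f = 0` or `F` is
rapidly decreasing on some conic neighbourhood of `f`. -/
def sigmaCone {L : Type*} (F : (E →L[ℝ] ℝ) → L → ℂ) : Set (E →L[ℝ] ℝ) :=
  {f | ¬ (f = 0 ∨ ∃ Γ : Set (E →L[ℝ] ℝ), IsConicNhd Γ f ∧
    ∀ (ℓ : L) (k : ℕ), ∃ C : ℝ, ∀ h ∈ Γ, ‖F h ℓ‖ ≤ C / (1 + ‖h‖) ^ k)}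

/-- The wave front set of `u` at `X`: the intersection of the cones `Σ(φ u)` over all test
densities `φ` with `φ(X) ≠ 0`. -/
def waveFrontAt {L : Type*} (ii : ℂ) (u : (E → ℂ) → L → ℂ) (X : E) : Set (E →L[ℝ] ℝ) :=
  ⋂ (φ : E → ℂ) (_ : IsTest φ) (_ : φ X ≠ 0), sigmaCone (fourierLoc ii u φ)

end WaveFront

/-! ### The orthosymplectic Lie superalgebra of `V = V₀ ⊕ V₁` -/

/-- The endomorphisms which leave a bilinear form invariant: this is `sp` of a symplectic form
and `so` of a symmetric form. -/
def infAut {W : Type*} [NormedAddCommGroup W] [NormedSpace ℝ W]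
    (B : LinearMap.BilinForm ℝ W) : Submodule ℝ (W →L[ℝ] W) where
  carrier := {X | ∀ v w, B (X v) w + B v (X w) = 0}
  zero_mem' := by intro v w; simp
  add_mem' := by
    intro X Y hX hY v w
    have h1 := hX v w
    have h2 := hY v w
    simp only [add_apply, map_add, LinearMap.add_apply]
    linarith
  smul_mem' := by
    intro s X hX v w
    have h1 := hX v w
    simp only [smul_apply, map_smul, LinearMap.smul_apply, smul_eq_mul]
    rw [← mul_add, h1, mul_zero]

section Spo

variable {V₀ V₁ : Type*}
  [NormedAddCommGroup V₀] [NormedSpace ℝ V₀]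
  [NormedAddCommGroup V₁] [NormedSpace ℝ V₁]

/-- The even part `sp(V₀) ⊕ so(V₁)` of `spo(V)`. -/
abbrev SpoEven (B₀ : LinearMap.BilinForm ℝ V₀) (B₁ : LinearMap.BilinForm ℝ V₁) : Type _ :=
  infAut B₀ × infAut B₁

/-- The odd part of `spo(V)`: the odd endomorphisms `(β, γ)`, with `β : V₁ → V₀` and
`γ : V₀ → V₁`, which leave `B` invariant, that is `B(Xv,w) + (-1)^{p(v)} B(v,Xw) = 0` for
homogeneous `v`, `w`. For `v` even and `w` odd this is the condition below; for `v` odd and `w`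
even it is the same condition, by the symmetries of `B₀` and `B₁`; otherwise it is trivial. -/
def spoOdd (B₀ : LinearMap.BilinForm ℝ V₀) (B₁ : LinearMap.BilinForm ℝ V₁) :
    Submodule ℝ ((V₁ →ₗ[ℝ] V₀) × (V₀ →ₗ[ℝ] V₁)) where
  carrier := {G | ∀ (v : V₀) (w : V₁), B₁ (G.2 v) w + B₀ v (G.1 w) = 0}
  zero_mem' := by intro v w; simp
  add_mem' := by
    intro X Y hX hY v w
    have h1 := hX v w
    have h2 := hY v w
    simp only [Prod.fst_add, Prod.snd_add, map_add, LinearMap.add_apply]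
    linarith
  smul_mem' := by
    intro s X hX v w
    have h1 := hX v w
    simp only [Prod.smul_fst, Prod.smul_snd, map_smul, LinearMap.smul_apply, smul_eq_mul]
    rw [← mul_add, h1, mul_zero]

/-- The moment map `v ↦ (X ↦ μ(X,v) = -½ B(v,Xv))` from `V₀` to the dual of the even part of
`spo(V)`. -/
def moment [FiniteDimensional ℝ V₀]
    (B₀ : LinearMap.BilinForm ℝ V₀) (B₁ : LinearMap.BilinForm ℝ V₁) (v : V₀) :
    SpoEven B₀ B₁ →L[ℝ] ℝ :=
  (-(1 / 2 : ℝ)) • ((LinearMap.toContinuousLinearMap (B₀ v)).comp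
    ((ContinuousLinearMap.apply ℝ V₀ v).comp
      ((infAut B₀).subtypeL.comp (ContinuousLinearMap.fst ℝ (infAut B₀) (infAut B₁)))))

/-! ### Symplectic bases -/

/-- A symplectic basis `e (0,0), e (0,1), e (1,0), e (1,1), …` of the symplectic space `V₀`. -/
structure IsSymplecticBasis {r : ℕ} (B₀ : LinearMap.BilinForm ℝ V₀)
    (e : Module.Basis (Fin r × Fin 2) ℝ V₀) : Prop where
  pair : ∀ k l, B₀ (e (k, 0)) (e (l, 1)) = if k = l then 1 else 0
  left : ∀ k l, B₀ (e (k, 0)) (e (l, 0)) = 0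
  right : ∀ k l, B₀ (e (k, 1)) (e (l, 1)) = 0

/-- The vectors `f j = c j • b j` form a symplectic basis of `V₁ ⊗ ℂ`: an orthonormal basis whose
elements belong to `V₁` or to `i V₁`. Such a basis orients `V₁` by `ξ¹ ⋯ ξⁿ`, where `ξ` is the
dual basis, and every orientation arises in this way if `n ≥ 1`. -/
structure IsOddSymplecticBasis {n : ℕ} (ii : ℂ) (B₁ : LinearMap.BilinForm ℝ V₁)
    (b : Module.Basis (Fin n) ℝ V₁) (c : Fin n → ℂ) : Prop where
  phase : ∀ j, c j = 1 ∨ c j = ii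
  orthonormal : ∀ i j, c i * c j * (B₁ (b i) (b j) : ℂ) = if i = j then 1 else 0

/-! ### Odd coordinates, the exponential, and the Berezin integral -/

/-- The complexified dual of a real vector space. -/
abbrev DualC (W : Type*) [AddCommGroup W] [Module ℝ W] : Type _ := W →ₗ[ℝ] ℂ

/-- A real linear form, seen in the complexified dual. -/
def toDualC {W : Type*} [AddCommGroup W] [Module ℝ W] (g : W →ₗ[ℝ] ℝ) : DualC W :=
  (Complex.ofRealCLM : ℝ →ₗ[ℝ] ℂ).comp g

/-- `Λ(V₁^* ⊕ spo(V)₁^*) ⊗ ℂ`: polynomials in the odd coordinates of `V` and of `spo(V)`. -/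
abbrev OddPoly (B₀ : LinearMap.BilinForm ℝ V₀) (B₁ : LinearMap.BilinForm ℝ V₁) : Type _ :=
  ExteriorAlgebra ℂ (DualC V₁ × DualC (spoOdd B₀ B₁))

/-- `Λ(spo(V)₁^*) ⊗ ℂ`, in which the superPfaffian takes its values. -/
abbrev Values (B₀ : LinearMap.BilinForm ℝ V₀) (B₁ : LinearMap.BilinForm ℝ V₁) : Type _ :=
  ExteriorAlgebra ℂ (DualC (spoOdd B₀ B₁))

/-- The odd coordinate `(β, γ) ↦ B₀(v, β w)` on the odd part of `spo(V)`. -/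
def betaCoord (B₀ : LinearMap.BilinForm ℝ V₀) (B₁ : LinearMap.BilinForm ℝ V₁)
    (v : V₀) (w : V₁) : DualC (spoOdd B₀ B₁) :=
  toDualC ((B₀ v).comp ((LinearMap.applyₗ w).comp
    ((LinearMap.fst ℝ (V₁ →ₗ[ℝ] V₀) (V₀ →ₗ[ℝ] V₁)).comp (spoOdd B₀ B₁).subtype)))

/-- The odd coordinate `(β, γ) ↦ B₁(w, γ v)` on the odd part of `spo(V)`. -/
def gammaCoord (B₀ : LinearMap.BilinForm ℝ V₀) (B₁ : LinearMap.BilinForm ℝ V₁)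
    (v : V₀) (w : V₁) : DualC (spoOdd B₀ B₁) :=
  toDualC ((B₁ w).comp ((LinearMap.applyₗ v).comp
    ((LinearMap.snd ℝ (V₁ →ₗ[ℝ] V₀) (V₀ →ₗ[ℝ] V₁)).comp (spoOdd B₀ B₁).subtype)))

/-- The part without constant term of `B(v,Xv) = ∑ B(g_i, G_k g_j) z^j Z^k z^i`, where
`v = v₀ + v₁` with `v₁ = ∑ b_j y^j` the generic point of `V₁`, and `X = X₀ + X₁ + Ξ` with
`X₀ ∈ sp(V₀)`, `X₁ ∈ so(V₁)` and `Ξ` the generic point of the odd part of `spo(V)`.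
The `i`-th term of the first sum is `(B₁(b_i, X₁ v₁) + B₁(b_i, Ξ v₀)) y^i`; the second sum is
`B₀(v₀, Ξ v₁)`. The constant term is `B₀(v₀, X₀ v₀)`. -/
def soulForm {n : ℕ} (B₀ : LinearMap.BilinForm ℝ V₀) (B₁ : LinearMap.BilinForm ℝ V₁)
    (b : Module.Basis (Fin n) ℝ V₁) (X : SpoEven B₀ B₁) (v : V₀) : OddPoly B₀ B₁ :=
  (∑ i, ExteriorAlgebra.ι ℂ
      (toDualC ((B₁ (b i)).comp (X.2 : V₁ →L[ℝ] V₁).toLinearMap), gammaCoord B₀ B₁ v (b i)) *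
    ExteriorAlgebra.ι ℂ (toDualC (b.coord i), (0 : DualC (spoOdd B₀ B₁)))) +
  ∑ j, ExteriorAlgebra.ι ℂ (toDualC (b.coord j), (0 : DualC (spoOdd B₀ B₁))) *
    ExteriorAlgebra.ι ℂ ((0 : DualC V₁), betaCoord B₀ B₁ v (b j))

/-- The exponential series of an element `a` without constant term of an exterior algebra on a
space of finite dimension `D`: it is a finite sum since `a ^ (D + 1) = 0`. -/
def expSoul {M : Type*} [AddCommGroup M] [Module ℂ M] (a : ExteriorAlgebra ℂ M) :
    ExteriorAlgebra ℂ M :=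
  ∑ k ∈ Finset.range (Module.finrank ℂ M + 1), ((k.factorial : ℂ)⁻¹) • a ^ k

/-- `exp(-(i/2) B(v,Xv))` as a function of the even variables `X` and `v`, with values in the
polynomials in the odd variables. -/
def superExp {n : ℕ} (ii : ℂ)
    (B₀ : LinearMap.BilinForm ℝ V₀) (B₁ : LinearMap.BilinForm ℝ V₁)
    (b : Module.Basis (Fin n) ℝ V₁) (X : SpoEven B₀ B₁) (v : V₀) : OddPoly B₀ B₁ :=
  Complex.exp (-(ii / 2) * (B₀ v ((X.1 : V₀ →L[ℝ] V₀) v) : ℂ)) •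
    expSoul ((-(ii / 2)) • soulForm B₀ B₁ b X v)

/-- Evaluation of the `V₁^* ⊗ ℂ`-component at the vector `f = z • w` of `V₁ ⊗ ℂ`. -/
def evalAt (B₀ : LinearMap.BilinForm ℝ V₀) (B₁ : LinearMap.BilinForm ℝ V₁) (z : ℂ) (w : V₁) :
    Module.Dual ℂ (DualC V₁ × DualC (spoOdd B₀ B₁)) where
  toFun p := z * p.1 w
  map_add' p q := by simp [mul_add]
  map_smul' s p := by simp; ring

/-- The Liouville integral of `V₁`, that is the Berezin integral
`φ ↦ (∂/∂ξ¹ ⋯ ∂/∂ξⁿ φ)|_{ξ = 0}` where `ξ` is the dual basis of `f j = c j • b j`; the odd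
derivation `∂/∂ξʲ` is the left contraction by `f j`. -/
def berezin {n : ℕ} (B₀ : LinearMap.BilinForm ℝ V₀) (B₁ : LinearMap.BilinForm ℝ V₁)
    (b : Module.Basis (Fin n) ℝ V₁) (c : Fin n → ℂ) : OddPoly B₀ B₁ →ₗ[ℂ] Values B₀ B₁ :=
  (ExteriorAlgebra.map
      (LinearMap.snd ℂ (DualC V₁) (DualC (spoOdd B₀ B₁)))).toLinearMap.comp
    ((List.finRange n).map fun j =>
      (CliffordAlgebra.contractLeft (evalAt B₀ B₁ (c j) (b j)) :
        Module.End ℂ (OddPoly B₀ B₁))).prod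

/-! ### The superPfaffian as a generalized function -/

variable [FiniteDimensional ℝ V₀] [FiniteDimensional ℝ V₁]

/-- The value at `v` of the integral over `spo(V)` and the odd variables of `V`:
`∫_{V₁} d_{V₁}(v₁) ∫ t(X) exp(-(i/2) B(v,Xv))`, for the smooth compactly supported distribution
on the even part of `spo(V)` with density `t`; component along `ℓ`. -/
def innerIntegral {n : ℕ} (ii : ℂ)
    (B₀ : LinearMap.BilinForm ℝ V₀) (B₁ : LinearMap.BilinForm ℝ V₁)
    (b : Module.Basis (Fin n) ℝ V₁) (c : Fin n → ℂ) (t : SpoEven B₀ B₁ → ℂ)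
    (ℓ : Module.Dual ℂ (Values B₀ B₁)) (v : V₀) : ℂ :=
  ∫ X : SpoEven B₀ B₁, t X * ℓ (berezin B₀ B₁ b c (superExp ii B₀ B₁ b X v))
    ∂(Measure.addHaar : Measure (SpoEven B₀ B₁))

/-- The superPfaffian
`Spf(X) = i^{(m-n)/2} ∫_V d_V(v) exp(-(i/2) B(v,Xv))`, `(m,n) = dim V`, `m = 2r`, as a generalized
function on the even part of `spo(V)` with values in `Λ(spo(V)₁^*) ⊗ ℂ`; component along `ℓ`. The
Liouville measure of `V₀` is `(2π)^{-m/2} |dx¹ ⋯ dxᵐ|` in symplectic coordinates. (For odd `n` the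
integral vanishes and the power of `i` is irrelevant.) -/
def Spf [MeasurableSpace V₀] [BorelSpace V₀] {r n : ℕ} (ii : ℂ)
    (B₀ : LinearMap.BilinForm ℝ V₀) (B₁ : LinearMap.BilinForm ℝ V₁)
    (e : Module.Basis (Fin r × Fin 2) ℝ V₀)
    (b : Module.Basis (Fin n) ℝ V₁) (c : Fin n → ℂ) (t : SpoEven B₀ B₁ → ℂ)
    (ℓ : Module.Dual ℂ (Values B₀ B₁)) : ℂ :=
  ii ^ (((2 * r : ℤ) - (n : ℤ)) / 2) * (((2 * Real.pi : ℝ) : ℂ) ^ r)⁻¹ *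
    ∫ v : V₀, innerIntegral ii B₀ B₁ b c t ℓ v ∂e.addHaar

end Spo

end SuperPfaffian

end

/-! The constant term of the exponent is the moment map, so the integrand is `exp(ii μ(v)(X))` times
the exponential of a nilpotent element. The latter is a finite sum, polynomial in `X` and `v`, and
stays so after Berezin integration. Hence every component of `Spf` on `t` is a constant times `∫ dv
∫ t(X) F(X,v) exp(ii μ(v)(X)) dX`, with `F` a finite sum of terms `p(X) q(v)`. The inner integral is
a sum of terms `q(v)` times the Fourier transform of the test density `t p` at frequency `μ(v)`.

Such a transform decays faster than any power of the frequency (`IsAmplitude.norm_fourier_le`).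
Since `μ` is continuous, homogeneous of degree two and vanishes only at `0`
(`eq_zero_of_moment_eq_zero`), `‖μ(v)‖` is at least a multiple of `‖v‖²`. The decay therefore beats
the polynomial growth of `q`, which gives absolute convergence.

Multiplying `t` by `exp(-ii h(X))` shifts the frequency to `μ(v) - h`. The range of `μ` is a closed
cone. Around a nonzero `f` off it there is an open cone of `h` on which `‖μ(v) - h‖` controls both
`‖v‖` and `‖h‖` (`exists_conicNhd_gap`). Part of the decay makes the `v`-integral converge and the
rest gives rapid decrease in `h`. -/

noncomputable section
namespace SuperPfaffian

set_option linter.unusedSectionVars false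

/-! ### Amplitudes with separated variables -/

section Amplitude

variable {E V A A' : Type*} [NormedAddCommGroup E] [NormedSpace ℝ E]
  [NormedAddCommGroup V] [NormedSpace ℝ V]

/-- Finite sums of products `p(X) q(v) a` with `p` smooth and `q` continuous of polynomial
growth. -/
inductive IsAmplitude [AddCommGroup A] [Module ℂ A] : (E → V → A) → Prop
  | pure (p : E → ℂ) (q : V → ℂ) (a : A) (hp : ContDiff ℝ ∞ p) (hq : Continuous q)
      (hg : ∃ (C : ℝ) (d : ℕ), ∀ v, ‖q v‖ ≤ C * (1 + ‖v‖) ^ d) :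
      IsAmplitude (fun X v => (p X * q v) • a)
  | add (F G : E → V → A) (hF : IsAmplitude F) (hG : IsAmplitude G) :
      IsAmplitude (fun X v => F X v + G X v)

namespace IsAmplitude

section Module

variable [AddCommGroup A] [Module ℂ A] [AddCommGroup A'] [Module ℂ A']

theorem const (a : A) : IsAmplitude (fun (_ : E) (_ : V) => a) := by
  simpa using IsAmplitude.pure (E := E) (V := V) (fun _ => 1) (fun _ => 1) a contDiff_const
    continuous_const ⟨1, 0, by simp⟩

theorem sum {ι : Type*} (s : Finset ι) {F : ι → E → V → A} (hF : ∀ i, IsAmplitude (F i)) :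
    IsAmplitude (fun X v => ∑ i ∈ s, F i X v) := by
  classical
  induction s using Finset.induction_on with
  | empty => simpa using const (0 : A)
  | insert i s hi ih => simpa [Finset.sum_insert hi] using IsAmplitude.add _ _ (hF i) ih

theorem map (L : A →ₗ[ℂ] A') {F : E → V → A} (hF : IsAmplitude F) :
    IsAmplitude (fun X v => L (F X v)) := by
  induction hF with
  | pure p q a hp hq hg => simpa using IsAmplitude.pure p q (L a) hp hq hg
  | add F G _ _ ihF ihG => simpa using IsAmplitude.add _ _ ihF ihG

theorem smul (s : ℂ) {F : E → V → A} (hF : IsAmplitude F) :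
    IsAmplitude (fun X v => s • F X v) :=
  hF.map (s • LinearMap.id)

theorem linear_left [FiniteDimensional ℝ E] (L : E →ₗ[ℝ] A) :
    IsAmplitude (fun X (_ : V) => L X) := by
  let β := Module.finBasis ℝ E
  have h (X : E) : L X = ∑ i, (((β.coord i X : ℝ) : ℂ) * 1) • L (β i) := by
    conv_lhs => rw [← β.sum_repr X]
    simp only [map_sum, map_smul, mul_one, Complex.coe_smul, Module.Basis.coord_apply]
  rw [funext fun X => funext fun _ : V => h X]
  refine sum _ fun i => IsAmplitude.pure (fun X => ((β.coord i X : ℝ) : ℂ)) (fun _ => 1) _ ?_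
    continuous_const ⟨1, 0, by simp⟩
  exact Complex.ofRealCLM.contDiff.comp (LinearMap.toContinuousLinearMap (β.coord i)).contDiff

theorem linear_right [FiniteDimensional ℝ V] (L : V →ₗ[ℝ] A) :
    IsAmplitude (fun (_ : E) v => L v) := by
  let β := Module.finBasis ℝ V
  have h (v : V) : L v = ∑ i, (1 * ((β.coord i v : ℝ) : ℂ)) • L (β i) := by
    conv_lhs => rw [← β.sum_repr v]
    simp only [map_sum, map_smul, one_mul, Complex.coe_smul, Module.Basis.coord_apply]
  rw [funext fun _ : E => funext h]
  refine sum _ fun i => IsAmplitude.pure (fun _ => 1) (fun v => ((β.coord i v : ℝ) : ℂ)) _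
    contDiff_const ?_ ?_
  · exact Complex.continuous_ofReal.comp (LinearMap.toContinuousLinearMap (β.coord i)).continuous
  · refine ⟨‖LinearMap.toContinuousLinearMap (β.coord i)‖, 1, fun v => ?_⟩
    have h1 := (LinearMap.toContinuousLinearMap (β.coord i)).le_opNorm v
    rw [Complex.norm_real]
    refine h1.trans ?_
    gcongr
    simp

end Module

section Algebra

variable [Ring A] [Algebra ℂ A]

theorem mul {F G : E → V → A} (hF : IsAmplitude F) (hG : IsAmplitude G) :
    IsAmplitude (fun X v => F X v * G X v) := by
  induction hF with
  | add F₁ F₂ _ _ ih₁ ih₂ => simpa [add_mul] using IsAmplitude.add _ _ ih₁ ih₂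
  | pure p q a hp hq hg =>
    induction hG with
    | add G₁ G₂ _ _ ih₁ ih₂ => simpa only [mul_add] using IsAmplitude.add _ _ ih₁ ih₂
    | pure p' q' a' hp' hq' hg' =>
      obtain ⟨C, d, h⟩ := hg
      obtain ⟨C', d', h'⟩ := hg'
      have := IsAmplitude.pure (fun X => p X * p' X) (fun v => q v * q' v) (a * a')
        (hp.mul hp') (hq.mul hq') ⟨C * C', d + d', fun v => by
          rw [norm_mul]
          calc ‖q v‖ * ‖q' v‖ ≤ (C * (1 + ‖v‖) ^ d) * (C' * (1 + ‖v‖) ^ d') :=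
                mul_le_mul (h v) (h' v) (norm_nonneg _) ((norm_nonneg _).trans (h v))
            _ = C * C' * (1 + ‖v‖) ^ (d + d') := by ring⟩
      convert this using 3 with X v
      rw [smul_mul_smul_comm]
      ring_nf

theorem pow {F : E → V → A} (hF : IsAmplitude F) (k : ℕ) :
    IsAmplitude (fun X v => F X v ^ k) := by
  induction k with
  | zero => simpa using const (1 : A)
  | succ k ih => simpa [pow_succ] using ih.mul hF

end Algebra

end IsAmplitude

end Amplitude

/-! ### Rapid decay of Fourier integrals -/

section Decay

variable {E : Type*} [NormedAddCommGroup E] [NormedSpace ℝ E] [FiniteDimensional ℝ E]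
  [MeasurableSpace E] [BorelSpace E] {μ : Measure E} [μ.IsAddHaarMeasure]

theorem IsTest.integrable {ψ : E → ℂ} (hψ : IsTest ψ) : Integrable ψ μ :=
  hψ.smooth.continuous.integrable_of_hasCompactSupport hψ.compact

theorem IsTest.mul_smooth {ψ p : E → ℂ} (hψ : IsTest ψ) (hp : ContDiff ℝ ∞ p) :
    IsTest (fun X => ψ X * p X) :=
  ⟨hψ.smooth.mul hp, hψ.compact.mul_right⟩

/-- Integration by parts in a direction `v` gains a factor `w v`; choosing `v` where `w` nearly
attains its norm turns this into a gain of `‖w‖`. -/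
theorem IsTest.pow_mul_norm_fourierIntegral_le {ψ : E → ℂ} (hψ : IsTest ψ) (k : ℕ) :
    ∃ C : ℝ, 0 ≤ C ∧ ∀ w : E →L[ℝ] ℝ, ‖w‖ ^ k *
      ‖∫ X, ψ X * Complex.exp ((2 * Real.pi * Complex.I) * (w X : ℂ)) ∂μ‖ ≤ C := by
  let L : E →L[ℝ] (E →L[ℝ] ℝ) →L[ℝ] ℝ := (ContinuousLinearMap.id ℝ (E →L[ℝ] ℝ)).flip
  have hint : ∀ j l : ℕ, (j : ℕ∞) ≤ ⊤ → (l : ℕ∞) ≤ ⊤ →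
      Integrable (fun v ↦ ‖v‖ ^ j * ‖iteratedFDeriv ℝ l ψ v‖) μ := by
    intro j l _ _
    refine Continuous.integrable_of_hasCompactSupport ?_ ?_
    · exact (continuous_norm.pow j).mul
        (hψ.smooth.continuous_iteratedFDeriv (by exact_mod_cast le_top)).norm
    · exact ((hψ.compact.iteratedFDeriv l).norm).mul_left
  set S := ∑ p ∈ Finset.range (0 + 1) ×ˢ Finset.range (k + 1),
          ∫ v, ‖v‖ ^ p.1 * ‖iteratedFDeriv ℝ p.2 ψ v‖ ∂μ with hS
  have hS0 : 0 ≤ S := Finset.sum_nonneg fun p _ => integral_nonneg fun v => by positivity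
  refine ⟨2 ^ k * (2 ^ k * S), by positivity, fun w => ?_⟩
  set J := ∫ X, ψ X * Complex.exp ((2 * Real.pi * Complex.I) * (w X : ℂ)) ∂μ with hJ
  -- The character in `VectorFourier.fourierIntegral` carries a minus sign, hence the evaluation at
  -- `-w`.
  have hJ' : VectorFourier.fourierIntegral Real.fourierChar μ L.toLinearMap₁₂ ψ (-w) = J := by
    rw [hJ, VectorFourier.fourierIntegral]
    refine integral_congr_ae (Filter.Eventually.of_forall fun X => ?_)
    have hL : L.toLinearMap₁₂ X (-w) = -(w X) := rfl
    simp only [hL, neg_neg, Circle.smul_def, Real.fourierChar_apply, smul_eq_mul]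
    rw [mul_comm]
    congr 2
    push_cast
    ring
  have key : ∀ v : E, |w v| ^ k * ‖J‖ ≤ ‖v‖ ^ k * (2 ^ k * S) := by
    intro v
    have := VectorFourier.pow_mul_norm_iteratedFDeriv_fourierIntegral_le (μ := μ) L
      (K := ⊤) (N := ⊤) hψ.smooth hint (k := 0) (n := k) le_top le_top v (-w)
    rw [norm_iteratedFDeriv_zero, hJ', ← hS] at this
    simpa [L, mul_assoc] using this
  rcases eq_or_ne w 0 with rfl | hw
  · have := key 0
    rcases Nat.eq_zero_or_pos k with rfl | hk
    · simpa using this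
    · rw [norm_zero, zero_pow hk.ne', zero_mul]
      positivity
  -- A vector of norm below `1` with `|w v| > ‖w‖ / 2`; the halving costs the factor `2 ^ k`.
  obtain ⟨v, hv1, hv2⟩ := w.exists_lt_apply_of_lt_opNorm (half_lt_self (norm_pos_iff.2 hw))
  calc ‖w‖ ^ k * ‖J‖ = 2 ^ k * ((‖w‖ / 2) ^ k * ‖J‖) := by rw [div_pow]; field_simp
    _ ≤ 2 ^ k * (|w v| ^ k * ‖J‖) := by gcongr; exact hv2.le
    _ ≤ 2 ^ k * (‖v‖ ^ k * (2 ^ k * S)) := by gcongr 2 ^ k * ?_; exact key v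
    _ ≤ 2 ^ k * (1 ^ k * (2 ^ k * S)) := by gcongr
    _ = _ := by simp

theorem eq_I_or_neg_I {ii : ℂ} (hii : ii ^ 2 = -1) :
    ∃ s : ℝ, |s| = 1 ∧ ii = s * Complex.I := by
  have : (ii - Complex.I) * (ii + Complex.I) = 0 := by
    linear_combination hii - Complex.I_sq
  rcases mul_eq_zero.1 this with h | h
  · exact ⟨1, by simp, by simpa using sub_eq_zero.1 h⟩
  · exact ⟨-1, by simp, by simpa using eq_neg_of_add_eq_zero_left h⟩

theorem norm_exp_mul_ofReal {ii : ℂ} (hii : ii ^ 2 = -1) (x : ℝ) :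
    ‖Complex.exp (ii * (x : ℂ))‖ = 1 := by
  obtain ⟨s, -, rfl⟩ := eq_I_or_neg_I hii
  rw [show (s : ℂ) * Complex.I * x = ((s * x : ℝ) : ℂ) * Complex.I by push_cast; ring]
  exact Complex.norm_exp_ofReal_mul_I _

/-- The Fourier transform of a smooth compactly supported density is rapidly decreasing. -/
theorem IsTest.norm_fourier_le {ii : ℂ} (hii : ii ^ 2 = -1) {ψ : E → ℂ} (hψ : IsTest ψ) (k : ℕ) :
    ∃ C : ℝ, 0 ≤ C ∧ ∀ η : E →L[ℝ] ℝ,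
      ‖∫ X, ψ X * Complex.exp (ii * (η X : ℂ)) ∂μ‖ ≤ C / (1 + ‖η‖) ^ k := by
  obtain ⟨s, hs, hsI⟩ := eq_I_or_neg_I hii
  obtain ⟨C₀, hC₀, h₀⟩ := hψ.pow_mul_norm_fourierIntegral_le (μ := μ) 0
  obtain ⟨C₁, hC₁, h₁⟩ := hψ.pow_mul_norm_fourierIntegral_le (μ := μ) k
  refine ⟨2 ^ (k - 1) * (C₀ + (2 * Real.pi) ^ k * C₁), by positivity, fun η => ?_⟩
  -- This rescaling passes to the `2π` normalisation, and `s = ±1` absorbs the choice of square root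
  -- of `-1`.
  set w : E →L[ℝ] ℝ := (s / (2 * Real.pi)) • η with hw
  have hpi := Real.pi_pos
  have hexp : (∫ X, ψ X * Complex.exp (ii * (η X : ℂ)) ∂μ) =
      ∫ X, ψ X * Complex.exp ((2 * Real.pi * Complex.I) * (w X : ℂ)) ∂μ := by
    congr 1
    ext X
    congr 2
    have : (Real.pi : ℂ) ≠ 0 := by exact_mod_cast hpi.ne'
    rw [hsI, hw]
    simp only [smul_apply, smul_eq_mul]
    push_cast
    field_simp
  have hnorm : ‖η‖ = 2 * Real.pi * ‖w‖ := by
    rw [hw, norm_smul, Real.norm_eq_abs, abs_div, hs, abs_of_pos (by positivity)]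
    field_simp
  have e₀ := h₀ w
  have e₁ := h₁ w
  rw [hexp, le_div_iff₀ (by positivity)]
  set J := ‖∫ X, ψ X * Complex.exp ((2 * Real.pi * Complex.I) * (w X : ℂ)) ∂μ‖
  calc J * (1 + ‖η‖) ^ k ≤ J * (2 ^ (k - 1) * (1 ^ k + ‖η‖ ^ k)) := by
        gcongr
        exact add_pow_le zero_le_one (norm_nonneg _) k
    _ = 2 ^ (k - 1) * (‖w‖ ^ 0 * J + (2 * Real.pi) ^ k * (‖w‖ ^ k * J)) := by
        rw [hnorm, mul_pow]; ring
    _ ≤ _ := by gcongr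

theorem IsTest.continuous_fourier {ii : ℂ} (hii : ii ^ 2 = -1) {ψ : E → ℂ} (hψ : IsTest ψ) :
    Continuous fun η : E →L[ℝ] ℝ => ∫ X, ψ X * Complex.exp (ii * (η X : ℂ)) ∂μ := by
  refine continuous_of_dominated (bound := fun X => ‖ψ X‖) (fun η => ?_) (fun η => ?_)
    hψ.integrable.norm (Filter.Eventually.of_forall fun X => ?_)
  · have := hψ.smooth.continuous
    exact Continuous.aestronglyMeasurable (by fun_prop)
  · refine Filter.Eventually.of_forall fun X => ?_
    rw [norm_mul, norm_exp_mul_ofReal hii, mul_one]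
  · fun_prop

variable {V : Type*} [NormedAddCommGroup V] [NormedSpace ℝ V]

theorem IsAmplitude.contDiff {F : E → V → ℂ} (hF : IsAmplitude F) (v : V) :
    ContDiff ℝ ∞ (fun X => F X v) := by
  induction hF with
  | pure p q a hp hq hg => exact (hp.mul contDiff_const).smul contDiff_const
  | add F G _ _ ihF ihG => exact ihF.add ihG

theorem integrable_test_mul_amplitude {ii : ℂ} (hii : ii ^ 2 = -1) {F : E → V → ℂ}
    (hF : IsAmplitude F) {φ : E → ℂ} (hφ : IsTest φ) (η : E →L[ℝ] ℝ) (v : V) :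
    Integrable (fun X => φ X * F X v * Complex.exp (ii * (η X : ℂ))) μ := by
  refine (hφ.mul_smooth (hF.contDiff v)).integrable.mul_bdd (c := 1) ?_ ?_
  · exact Continuous.aestronglyMeasurable (by fun_prop)
  · exact Filter.Eventually.of_forall fun X => (norm_exp_mul_ofReal hii _).le

/-- Fourier integrals with an amplitude grow polynomially in the parameter and decrease rapidly
in the frequency. -/
theorem IsAmplitude.norm_fourier_le {ii : ℂ} (hii : ii ^ 2 = -1) {F : E → V → ℂ}
    (hF : IsAmplitude F) {φ : E → ℂ} (hφ : IsTest φ) :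
    ∃ d : ℕ, ∀ k : ℕ, ∃ C : ℝ, 0 ≤ C ∧ ∀ (v : V) (η : E →L[ℝ] ℝ),
      ‖∫ X, φ X * F X v * Complex.exp (ii * (η X : ℂ)) ∂μ‖ ≤
        C * (1 + ‖v‖) ^ d / (1 + ‖η‖) ^ k := by
  induction hF with
  | pure p q a hp hq hg =>
    obtain ⟨D, d, hD⟩ := hg
    -- The growth exponent `d` comes from `q` alone. Its independence of `k` allows `k` to be chosen
    -- later in terms of `d`.
    refine ⟨d, fun k => ?_⟩
    obtain ⟨C, hC, h⟩ := (hφ.mul_smooth hp).norm_fourier_le (μ := μ) hii k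
    have hD0 : 0 ≤ D := by simpa using (norm_nonneg _).trans (hD 0)
    refine ⟨D * ‖a‖ * C, by positivity, fun v η => ?_⟩
    -- The factor `q v` leaves the integral, and the remaining density `φ p` does not involve `v`,
    -- so one decay constant serves all `v`.
    have e : (∫ X, φ X * ((p X * q v) • a) * Complex.exp (ii * (η X : ℂ)) ∂μ) =
        (q v * a) * ∫ X, φ X * p X * Complex.exp (ii * (η X : ℂ)) ∂μ := by
      rw [← integral_const_mul]
      congr 1
      ext X
      simp only [smul_eq_mul]
      ring
    rw [e, norm_mul, norm_mul]
    calc ‖q v‖ * ‖a‖ * _ ≤ (D * (1 + ‖v‖) ^ d) * ‖a‖ * (C / (1 + ‖η‖) ^ k) := by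
          gcongr
          · exact hD v
          · exact h η
      _ = _ := by ring
  | add F G hF hG ihF ihG =>
    obtain ⟨d, h⟩ := ihF
    obtain ⟨d', h'⟩ := ihG
    refine ⟨max d d', fun k => ?_⟩
    obtain ⟨C, hC, h⟩ := h k
    obtain ⟨C', hC', h'⟩ := h' k
    refine ⟨C + C', by positivity, fun v η => ?_⟩
    simp only [mul_add, add_mul]
    rw [integral_add (integrable_test_mul_amplitude hii hF hφ η v)
      (integrable_test_mul_amplitude hii hG hφ η v), add_div]
    have h1 : 1 ≤ 1 + ‖v‖ := by simp
    refine (norm_add_le _ _).trans (add_le_add ((h v η).trans ?_) ((h' v η).trans ?_))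
    · gcongr
      exact le_max_left _ _
    · gcongr
      exact le_max_right _ _

theorem IsAmplitude.continuous_fourier {ii : ℂ} (hii : ii ^ 2 = -1) {F : E → V → ℂ}
    (hF : IsAmplitude F) {φ : E → ℂ} (hφ : IsTest φ) {m : V → E →L[ℝ] ℝ} (hm : Continuous m) :
    Continuous fun v => ∫ X, φ X * F X v * Complex.exp (ii * (m v X : ℂ)) ∂μ := by
  induction hF with
  | pure p q a hp hq hg =>
    have e : (fun v => ∫ X, φ X * ((p X * q v) • a) * Complex.exp (ii * (m v X : ℂ)) ∂μ) =
        fun v => (q v * a) * ∫ X, φ X * p X * Complex.exp (ii * (m v X : ℂ)) ∂μ := by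
      ext v
      rw [← integral_const_mul]
      congr 1
      ext X
      simp only [smul_eq_mul]
      ring
    rw [e]
    exact (hq.mul continuous_const).mul
      (((hφ.mul_smooth hp).continuous_fourier hii).comp hm)
  | add F G hF hG ihF ihG =>
    have e (v : V) := integral_add (integrable_test_mul_amplitude (μ := μ) hii hF hφ (m v) v)
      (integrable_test_mul_amplitude (μ := μ) hii hG hφ (m v) v)
    simp only [mul_add, add_mul]
    rw [funext e]
    exact ihF.add ihG

end Decay

/-! ### Superposition of characters along a quadratic map -/

section Quadratic

variable {E V : Type*} [NormedAddCommGroup E] [NormedSpace ℝ E] [FiniteDimensional ℝ E]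
  [MeasurableSpace E] [BorelSpace E] {μ : Measure E} [μ.IsAddHaarMeasure]
  [NormedAddCommGroup V] [NormedSpace ℝ V] [FiniteDimensional ℝ V]
  [MeasurableSpace V] [BorelSpace V] {ν : Measure V} [ν.IsAddHaarMeasure]
  {m : V → E →L[ℝ] ℝ}

/-- A continuous anisotropic map which is homogeneous of degree two grows quadratically. -/
theorem exists_mul_sq_le_norm (hm : Continuous m) (hsq : ∀ (s : ℝ) v, m (s • v) = s ^ 2 • m v)
    (h0 : ∀ v, m v = 0 → v = 0) : ∃ c : ℝ, 0 < c ∧ c ≤ 1 ∧ ∀ v, c * ‖v‖ ^ 2 ≤ ‖m v‖ := by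
  -- An empty unit sphere means `V = 0`. Otherwise the minimum of `‖m‖` on the sphere is positive,
  -- and homogeneity spreads it.
  rcases (Metric.sphere (0 : V) 1).eq_empty_or_nonempty with he | hne
  · refine ⟨1, one_pos, le_rfl, fun v => ?_⟩
    rcases eq_or_ne v 0 with rfl | hv
    · simp
    · have : ‖v‖⁻¹ • v ∈ Metric.sphere (0 : V) 1 := by
        simp [norm_smul, hv]
      simp [he] at this
  obtain ⟨x, hx, hmin⟩ := (isCompact_sphere (0 : V) 1).exists_isMinOn hne hm.norm.continuousOn
  have hx0 : x ≠ 0 := by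
    rintro rfl
    simp at hx
  have hpos : 0 < ‖m x‖ := norm_pos_iff.2 fun h => hx0 (h0 x h)
  refine ⟨min 1 ‖m x‖, lt_min one_pos hpos, min_le_left _ _, fun v => ?_⟩
  rcases eq_or_ne v 0 with rfl | hv
  · simp
  have hs : ‖v‖⁻¹ • v ∈ Metric.sphere (0 : V) 1 := by
    simp [norm_smul, hv]
  have h1 : ‖m x‖ ≤ ‖m (‖v‖⁻¹ • v)‖ := hmin hs
  have hv' : 0 < ‖v‖ := norm_pos_iff.2 hv
  rw [hsq, norm_smul, norm_pow, norm_inv, norm_norm] at h1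
  calc min 1 ‖m x‖ * ‖v‖ ^ 2 ≤ ((‖v‖⁻¹) ^ 2 * ‖m v‖) * ‖v‖ ^ 2 := by
        gcongr
        exact (min_le_right _ _).trans h1
    _ = ‖m v‖ := by field_simp

/-- The quadratic lower bound makes `m` proper. -/
theorem isClosed_range_of_mul_sq_le (hm : Continuous m) {c : ℝ} (hc : 0 < c)
    (hmc : ∀ v, c * ‖v‖ ^ 2 ≤ ‖m v‖) : IsClosed (Set.range m) := by
  refine (isProperMap_iff_tendsto_cocompact.2 ⟨hm, ?_⟩).isClosedMap.isClosed_range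
  rw [← Metric.cobounded_eq_cocompact, ← Metric.cobounded_eq_cocompact,
    ← tendsto_norm_atTop_iff_cobounded]
  refine Filter.tendsto_atTop_mono hmc ?_
  exact ((Filter.tendsto_pow_atTop two_ne_zero).comp tendsto_norm_cobounded_atTop).const_mul_atTop hc

/-- A conic neighbourhood of a point off the range of `m`, on which the distance to the range is
bounded below. -/
theorem exists_conicNhd_gap (hm : Continuous m)
    (hsq : ∀ (s : ℝ) v, m (s • v) = s ^ 2 • m v) (h0 : ∀ v, m v = 0 → v = 0)
    {f : E →L[ℝ] ℝ} (hf0 : f ≠ 0) (hf : f ∉ Set.range m) :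
    ∃ Γ, IsConicNhd Γ f ∧ ∃ c : ℝ, 0 < c ∧ c ≤ 1 ∧ ∀ h ∈ Γ, ∀ v,
      c * (1 + ‖v‖) ≤ 1 + ‖m v - h‖ ∧ c * (1 + ‖h‖) ≤ 1 + ‖m v - h‖ := by
  obtain ⟨a, ha, ha1, hma⟩ := exists_mul_sq_le_norm hm hsq h0
  have hcl := isClosed_range_of_mul_sq_le hm ha hma
  have hne : (Set.range m).Nonempty := ⟨m 0, 0, rfl⟩
  have hd : 0 < Metric.infDist f (Set.range m) := (hcl.notMem_iff_infDist_pos hne).1 hf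
  have hfn : 0 < ‖f‖ := norm_pos_iff.2 hf0
  set ε := min 1 (Metric.infDist f (Set.range m) / (2 * ‖f‖)) with hε
  have hε0 : 0 < ε := lt_min one_pos (by positivity)
  have hε1 : ε ≤ 1 := min_le_left _ _
  -- The cone of points whose distance to the range is more than `ε` times their norm. The factor
  -- `2` in `ε` makes the inequality strict at `f`.
  refine ⟨{h | ε * ‖h‖ < Metric.infDist h (Set.range m)}, ⟨?_, ?_, ?_⟩,
    ε * a / 4, by positivity, ?_, ?_⟩
  · exact isOpen_lt (by fun_prop) (Metric.continuous_infDist_pt _)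
  · calc ε * ‖f‖ ≤ Metric.infDist f (Set.range m) / (2 * ‖f‖) * ‖f‖ := by
          gcongr
          exact min_le_right _ _
      _ = Metric.infDist f (Set.range m) / 2 := by field_simp
      _ < Metric.infDist f (Set.range m) := half_lt_self hd
  · intro h hh s hs
    simp only [Set.mem_ofPred_eq] at hh ⊢
    have hle : s * Metric.infDist h (Set.range m) ≤ Metric.infDist (s • h) (Set.range m) := by
      rw [Metric.le_infDist hne]
      rintro _ ⟨v, rfl⟩
      -- The range is invariant under positive scaling: multiplying `m v` by `s` amounts to
      -- multiplying `v` by `√s`.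
      have e : m v = s • m ((Real.sqrt s)⁻¹ • v) := by
        rw [hsq, smul_smul, inv_pow, Real.sq_sqrt hs.le, mul_inv_cancel₀ hs.ne', one_smul]
      have e' : s • h - s • m ((Real.sqrt s)⁻¹ • v) = s • (h - m ((Real.sqrt s)⁻¹ • v)) :=
        (smul_sub _ _ _).symm
      rw [e, dist_eq_norm, e', norm_smul, Real.norm_eq_abs, abs_of_pos hs, ← dist_eq_norm]
      gcongr
      exact Metric.infDist_le_dist_of_mem ⟨_, rfl⟩
    calc ε * ‖s • h‖ = s * (ε * ‖h‖) := by
          rw [norm_smul, Real.norm_eq_abs, abs_of_pos hs]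
          ring
      _ < s * Metric.infDist h (Set.range m) := by gcongr
      _ ≤ _ := hle
  · have : ε * a ≤ 1 := mul_le_one₀ hε1 ha.le ha1
    linarith
  · intro h hh v
    have h1 : ε * ‖h‖ ≤ ‖m v - h‖ := by
      rw [← dist_eq_norm, dist_comm]
      exact (le_of_lt hh).trans (Metric.infDist_le_dist_of_mem (Set.mem_range_self v))
    have h2 : ‖m v‖ ≤ ‖m v - h‖ + ‖h‖ := by simpa using norm_add_le (m v - h) h
    have h3 : ε * (a * ‖v‖ ^ 2) ≤ ε * (‖m v - h‖ + ‖h‖) := by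
      gcongr
      exact (hma v).trans h2
    have h4 : ε * ‖m v - h‖ ≤ 1 * ‖m v - h‖ := by gcongr
    have h5 : ε * a ≤ 1 := mul_le_one₀ hε1 ha.le ha1
    have h6 : ε * a * (1 + ‖v‖) ≤ ε * a * (2 + ‖v‖ ^ 2) := by
      refine mul_le_mul_of_nonneg_left ?_ (by positivity)
      nlinarith [sq_nonneg (‖v‖ - 1)]
    have h7 : a * (ε * (1 + ‖h‖)) ≤ 1 * (ε * (1 + ‖h‖)) := by gcongr
    have h8 := norm_nonneg (m v - h)
    constructor <;> nlinarith

/-- Of the `k + (d + N)` powers of `D`, `k` give decay in `y`, `d` cancel the growth in `x`, and `N`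
remain for integrability in `x`. -/
theorem pow_div_pow_le {c x y D : ℝ} (hc : 0 < c) (hx : 0 ≤ x) (hy : 0 ≤ y)
    (h₁ : c * (1 + x) ≤ D) (h₂ : c * (1 + y) ≤ D) (d k N : ℕ) :
    (1 + x) ^ d / D ^ (k + (d + N)) ≤
      (c ^ (k + (d + N)))⁻¹ / (1 + y) ^ k * ((1 + x) ^ N)⁻¹ := by
  have hD : (c * (1 + y)) ^ k * (c * (1 + x)) ^ (d + N) ≤ D ^ (k + (d + N)) := by
    have : 0 ≤ D := le_trans (by positivity) h₁
    rw [pow_add D]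
    gcongr
  calc (1 + x) ^ d / D ^ (k + (d + N)) ≤
        (1 + x) ^ d / ((c * (1 + y)) ^ k * (c * (1 + x)) ^ (d + N)) := by gcongr
    _ = _ := by
      rw [mul_pow, mul_pow, pow_add (1 + x)]
      field_simp
      ring

theorem integrable_inv_one_add_norm_pow :
    Integrable (fun v : V => ((1 + ‖v‖) ^ (Module.finrank ℝ V + 1))⁻¹) ν := by
  have h := integrable_one_add_norm (E := V) (μ := ν)
    (r := ((Module.finrank ℝ V + 1 : ℕ) : ℝ)) (by push_cast; linarith)
  refine h.congr (Filter.Eventually.of_forall fun v => ?_)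
  simp only
  rw [Real.rpow_neg (by positivity), Real.rpow_natCast]

variable {F : E → V → ℂ}

theorem IsAmplitude.integrable_fourier {ii : ℂ} (hii : ii ^ 2 = -1) (hF : IsAmplitude F)
    (hm : Continuous m) (hsq : ∀ (s : ℝ) v, m (s • v) = s ^ 2 • m v)
    (h0 : ∀ v, m v = 0 → v = 0) {φ : E → ℂ} (hφ : IsTest φ) :
    Integrable (fun v => ∫ X, φ X * F X v * Complex.exp (ii * (m v X : ℂ)) ∂μ) ν := by
  obtain ⟨a, ha, ha1, hma⟩ := exists_mul_sq_le_norm hm hsq h0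
  obtain ⟨d, hd⟩ := hF.norm_fourier_le (μ := μ) hii hφ
  set N := Module.finrank ℝ V + 1
  obtain ⟨C, hC, h⟩ := hd (0 + (d + N))
  refine ((integrable_inv_one_add_norm_pow (ν := ν)).const_mul
    (C * ((a / 2) ^ (0 + (d + N)))⁻¹)).mono'
    (hF.continuous_fourier hii hφ hm).aestronglyMeasurable
    (Filter.Eventually.of_forall fun v => (h v (m v)).trans ?_)
  have h1 : a / 2 * (1 + ‖v‖) ≤ 1 + ‖m v‖ := by
    nlinarith [sq_nonneg (‖v‖ - 1), hma v]
  have h2 : a / 2 * (1 + 0) ≤ 1 + ‖m v‖ := by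
    linarith [norm_nonneg (m v)]
  -- No decay in a second variable is needed here, hence `y = 0` and `k = 0`.
  have := pow_div_pow_le (by positivity) (norm_nonneg v) le_rfl h1 h2 d 0 N
  rw [mul_div_assoc]
  exact (mul_le_mul_of_nonneg_left this hC).trans_eq (by simp [mul_assoc, N])

/-- The wave front set of a superposition of the characters `exp(i m(v))` along a quadratic map
`m`, with amplitudes `F`, is contained in the range of `m`. -/
theorem waveFrontAt_subset_range {ii : ℂ} (hii : ii ^ 2 = -1) {L : Type*} {F : L → E → V → ℂ}
    (hF : ∀ ℓ, IsAmplitude (F ℓ))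
    (hm : Continuous m) (hsq : ∀ (s : ℝ) v, m (s • v) = s ^ 2 • m v)
    (h0 : ∀ v, m v = 0 → v = 0) {u : (E → ℂ) → L → ℂ} {K : ℂ}
    (hu : ∀ t ℓ, u t ℓ =
      K * ∫ v, ∫ X, t X * F ℓ X v * Complex.exp (ii * (m v X : ℂ)) ∂μ ∂ν) (X : E) :
    waveFrontAt ii u X ⊆ Set.range m \ {0} := by
  intro f hf
  -- The wave front set is an intersection over all cutoffs, so a single bump function at `X`
  -- suffices.
  obtain ⟨β⟩ : Nonempty (ContDiffBump X) := inferInstance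
  have hφ : IsTest (fun Y => ((β Y : ℝ) : ℂ)) :=
    ⟨Complex.ofRealCLM.contDiff.comp β.contDiff,
      β.hasCompactSupport.comp_left (g := ((↑) : ℝ → ℂ)) Complex.ofReal_zero⟩
  set φ : E → ℂ := fun Y => ((β Y : ℝ) : ℂ) with hφdef
  have hφX : φ X ≠ 0 := by
    have := β.one_of_mem_closedBall (Metric.mem_closedBall_self β.rIn_pos.le)
    simp [hφdef, this]
  have hfφ : f ∈ sigmaCone (fourierLoc ii u φ) := Set.mem_iInter₂.1 (Set.mem_iInter.1 hf φ) hφ hφX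
  simp only [sigmaCone, Set.mem_ofPred_eq, not_or] at hfφ
  obtain ⟨hf0, hdec⟩ := hfφ
  refine ⟨by_contra fun hfr => hdec ?_, hf0⟩
  obtain ⟨Γ, hΓ, c, hc, -, hgap⟩ := exists_conicNhd_gap hm hsq h0 hf0 hfr
  refine ⟨Γ, hΓ, fun ℓ k => ?_⟩
  obtain ⟨d, hd⟩ := (hF ℓ).norm_fourier_le (μ := μ) hii hφ
  set N := Module.finrank ℝ V + 1 with hN
  obtain ⟨C, hC, hCle⟩ := hd (k + (d + N))
  set I := ∫ v : V, ((1 + ‖v‖) ^ N)⁻¹ ∂ν with hI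
  refine ⟨‖K‖ * (C * (c ^ (k + (d + N)))⁻¹ * I), fun h hh => ?_⟩
  -- The factor `exp(-ii h)` shifts the frequency from `m v` to `m v - h`.
  have e : fourierLoc ii u φ h ℓ =
      K * ∫ v, ∫ Y, φ Y * F ℓ Y v * Complex.exp (ii * ((m v - h) Y : ℂ)) ∂μ ∂ν := by
    rw [fourierLoc, hu]
    congr 3
    ext v
    congr 1
    ext Y
    rw [sub_apply, Complex.ofReal_sub, mul_sub, sub_eq_neg_add, Complex.exp_add, neg_mul]
    ring
  rw [e, norm_mul, mul_div_assoc]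
  gcongr
  have hb (v : V) : ‖∫ Y, φ Y * F ℓ Y v * Complex.exp (ii * ((m v - h) Y : ℂ)) ∂μ‖ ≤
      C * (c ^ (k + (d + N)))⁻¹ / (1 + ‖h‖) ^ k * ((1 + ‖v‖) ^ N)⁻¹ := by
    refine (hCle v (m v - h)).trans ?_
    have := pow_div_pow_le hc (norm_nonneg v) (norm_nonneg h) (hgap h hh v).1 (hgap h hh v).2 d k N
    rw [mul_div_assoc]
    exact (mul_le_mul_of_nonneg_left this hC).trans_eq (by ring)
  refine (norm_integral_le_of_norm_le ((integrable_inv_one_add_norm_pow (ν := ν)).const_mul _)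
    (Filter.Eventually.of_forall hb)).trans ?_
  rw [integral_const_mul, ← hN, ← hI]
  exact le_of_eq (by ring)

end Quadratic

/-! ### The moment map and the odd variables -/

section Spo

variable {V₀ V₁ : Type*}
  [NormedAddCommGroup V₀] [NormedSpace ℝ V₀] [FiniteDimensional ℝ V₀]
  [NormedAddCommGroup V₁] [NormedSpace ℝ V₁] [FiniteDimensional ℝ V₁]
  {B₀ : LinearMap.BilinForm ℝ V₀} {B₁ : LinearMap.BilinForm ℝ V₁}

theorem moment_apply (v : V₀) (X : SpoEven B₀ B₁) :
    moment B₀ B₁ v X = -(1 / 2 : ℝ) * B₀ v ((X.1 : V₀ →L[ℝ] V₀) v) := rfl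

theorem moment_smul (s : ℝ) (v : V₀) : moment B₀ B₁ (s • v) = s ^ 2 • moment B₀ B₁ v := by
  refine ContinuousLinearMap.ext fun X => ?_
  simp only [smul_apply, moment_apply, map_smul, LinearMap.smul_apply, smul_eq_mul]
  ring

theorem continuous_moment : Continuous (moment B₀ B₁) := by
  have h1 : Continuous fun v : V₀ => LinearMap.toContinuousLinearMap (B₀ v) :=
    ((LinearMap.toContinuousLinearMap (𝕜 := ℝ) (E := V₀) (F' := ℝ)).toLinearMap.comp
      B₀).continuous_of_finiteDimensional
  refine (continuous_clm_apply (𝕜 := ℝ) (E := SpoEven B₀ B₁) (F := ℝ)).2 fun X => ?_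
  have h2 : Continuous fun v : V₀ =>
      LinearMap.toContinuousLinearMap (B₀ v) ((X.1 : V₀ →L[ℝ] V₀) v) :=
    h1.clm_apply (X.1 : V₀ →L[ℝ] V₀).continuous
  exact continuous_const.mul h2

/-- The infinitesimal symplectic transvection `v ↦ B₀(a, v) a`. -/
def transvection (hB₀ : B₀.IsAlt) (a : V₀) : infAut B₀ :=
  ⟨LinearMap.toContinuousLinearMap ((B₀ a).smulRight a), fun v w => by
    have := hB₀.neg_eq v a
    simp [← this, mul_comm]⟩

/-- Pairing the moment of `v` with the transvection along `a` gives `½ B₀(v,a)²`, so vanishing for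
all `a` contradicts nondegeneracy unless `v = 0`. -/
theorem eq_zero_of_moment_eq_zero (hB₀ : B₀.IsAlt) (hB₀' : B₀.Nondegenerate) (v : V₀)
    (h : moment B₀ B₁ v = 0) : v = 0 := by
  refine hB₀'.1 v fun a => ?_
  have h1 : moment B₀ B₁ v (transvection hB₀ a, 0) = 0 := by rw [h]; rfl
  have h2 := hB₀.neg_eq v a
  rw [moment_apply] at h1
  simp only [transvection, LinearMap.coe_toContinuousLinearMap', LinearMap.smulRight_apply,
    map_smul, smul_eq_mul, ← h2] at h1
  nlinarith

variable {n : ℕ}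

theorem gammaCoord_add (v w : V₀) (x : V₁) :
    gammaCoord B₀ B₁ (v + w) x = gammaCoord B₀ B₁ v x + gammaCoord B₀ B₁ w x :=
  LinearMap.ext fun G => by simp [toDualC, gammaCoord]

theorem gammaCoord_smul (s : ℝ) (v : V₀) (x : V₁) :
    gammaCoord B₀ B₁ (s • v) x = (s : ℂ) • gammaCoord B₀ B₁ v x :=
  LinearMap.ext fun G => by simp [toDualC, gammaCoord]

theorem betaCoord_add (v w : V₀) (x : V₁) :
    betaCoord B₀ B₁ (v + w) x = betaCoord B₀ B₁ v x + betaCoord B₀ B₁ w x :=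
  LinearMap.ext fun G => by simp [toDualC, betaCoord]

theorem betaCoord_smul (s : ℝ) (v : V₀) (x : V₁) :
    betaCoord B₀ B₁ (s • v) x = (s : ℂ) • betaCoord B₀ B₁ v x :=
  LinearMap.ext fun G => by simp [toDualC, betaCoord]

/-- The real linear map into an exterior algebra defined by a real linear map into the
generators. -/
def realι {W M : Type*} [AddCommGroup W] [Module ℝ W] [AddCommGroup M] [Module ℂ M]
    (g : W → M) (hadd : ∀ v w, g (v + w) = g v + g w)
    (hsmul : ∀ (s : ℝ) v, g (s • v) = (s : ℂ) • g v) : W →ₗ[ℝ] ExteriorAlgebra ℂ M where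
  toFun v := ExteriorAlgebra.ι ℂ (g v)
  map_add' v w := by rw [hadd, map_add]
  map_smul' s v := by rw [hsmul, map_smul, RingHom.id_apply, Complex.coe_smul]

theorem isAmplitude_soulForm (b : Module.Basis (Fin n) ℝ V₁) :
    IsAmplitude (soulForm B₀ B₁ b) := by
  have hX (i : Fin n) : IsAmplitude (fun (X : SpoEven B₀ B₁) (_ : V₀) =>
      ExteriorAlgebra.ι ℂ (toDualC ((B₁ (b i)).comp (X.2 : V₁ →L[ℝ] V₁).toLinearMap),
        (0 : DualC (spoOdd B₀ B₁)))) :=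
    IsAmplitude.linear_left (realι (fun X : SpoEven B₀ B₁ =>
      (toDualC ((B₁ (b i)).comp (X.2 : V₁ →L[ℝ] V₁).toLinearMap), (0 : DualC (spoOdd B₀ B₁))))
      (fun X Y => Prod.ext (LinearMap.ext fun w => by simp [toDualC]) (add_zero 0).symm)
      (fun s X => Prod.ext (LinearMap.ext fun w => by simp [toDualC]) (smul_zero _).symm))
  have hγ (i : Fin n) : IsAmplitude (fun (_ : SpoEven B₀ B₁) (v : V₀) =>
      ExteriorAlgebra.ι ℂ ((0 : DualC V₁), gammaCoord B₀ B₁ v (b i))) :=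
    IsAmplitude.linear_right (realι (fun v => ((0 : DualC V₁), gammaCoord B₀ B₁ v (b i)))
      (fun v w => Prod.ext (add_zero 0).symm (gammaCoord_add v w _))
      (fun s v => Prod.ext (smul_zero _).symm (gammaCoord_smul s v _)))
  have hβ (i : Fin n) : IsAmplitude (fun (_ : SpoEven B₀ B₁) (v : V₀) =>
      ExteriorAlgebra.ι ℂ ((0 : DualC V₁), betaCoord B₀ B₁ v (b i))) :=
    IsAmplitude.linear_right (realι (fun v => ((0 : DualC V₁), betaCoord B₀ B₁ v (b i)))
      (fun v w => Prod.ext (add_zero 0).symm (betaCoord_add v w _))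
      (fun s v => Prod.ext (smul_zero _).symm (betaCoord_smul s v _)))
  -- The generator mixing `X` and `v` is split into one linear in `X` and one linear in `v`, each of
  -- which is an amplitude.
  have hadd (i : Fin n) (X : SpoEven B₀ B₁) (v : V₀) :
      ExteriorAlgebra.ι ℂ (toDualC ((B₁ (b i)).comp (X.2 : V₁ →L[ℝ] V₁).toLinearMap),
        gammaCoord B₀ B₁ v (b i)) =
      ExteriorAlgebra.ι ℂ (toDualC ((B₁ (b i)).comp (X.2 : V₁ →L[ℝ] V₁).toLinearMap),
        (0 : DualC (spoOdd B₀ B₁))) +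
      ExteriorAlgebra.ι ℂ ((0 : DualC V₁), gammaCoord B₀ B₁ v (b i)) := by
    rw [← map_add, Prod.mk_add_mk, add_zero, zero_add]
  unfold soulForm
  simp_rw [hadd]
  exact .add _ _
    (.sum _ fun i => (IsAmplitude.add _ _ (hX i) (hγ i)).mul (.const _))
    (.sum _ fun i => (IsAmplitude.const _).mul (hβ i))

theorem isAmplitude_berezin_expSoul (ii : ℂ) (b : Module.Basis (Fin n) ℝ V₁) (c : Fin n → ℂ)
    (ℓ : Module.Dual ℂ (Values B₀ B₁)) :
    IsAmplitude (fun X v =>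
      ℓ (berezin B₀ B₁ b c (expSoul ((-(ii / 2)) • soulForm B₀ B₁ b X v)))) := by
  refine IsAmplitude.map ℓ (IsAmplitude.map (berezin B₀ B₁ b c) ?_)
  unfold expSoul
  exact .sum _ fun k => (((isAmplitude_soulForm b).smul _).pow k).smul _

/-- The constant term of the exponent is even and scalar, so it passes through the Berezin integral
as the oscillating factor of frequency `moment B₀ B₁ v`. -/
theorem innerIntegral_eq (ii : ℂ) (b : Module.Basis (Fin n) ℝ V₁) (c : Fin n → ℂ)
    (t : SpoEven B₀ B₁ → ℂ) (ℓ : Module.Dual ℂ (Values B₀ B₁)) (v : V₀) :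
    innerIntegral ii B₀ B₁ b c t ℓ v =
      ∫ X, t X * ℓ (berezin B₀ B₁ b c (expSoul ((-(ii / 2)) • soulForm B₀ B₁ b X v))) *
        Complex.exp (ii * (moment B₀ B₁ v X : ℂ))
        ∂(Measure.addHaar : Measure (SpoEven B₀ B₁)) := by
  unfold innerIntegral superExp
  congr 1
  ext X
  rw [map_smul, map_smul, smul_eq_mul, moment_apply]
  have : -(ii / 2) * (B₀ v ((X.1 : V₀ →L[ℝ] V₀) v) : ℂ) =
      ii * ((-(1 / 2 : ℝ) * B₀ v ((X.1 : V₀ →L[ℝ] V₀) v) : ℝ) : ℂ) := by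
    push_cast
    ring
  rw [this]
  ring

end Spo

end SuperPfaffian

end

theorem mainTheorem8 {V₀ V₁ : Type*}
    [NormedAddCommGroup V₀] [NormedSpace ℝ V₀] [FiniteDimensional ℝ V₀]
    [MeasurableSpace V₀] [BorelSpace V₀]
    [NormedAddCommGroup V₁] [NormedSpace ℝ V₁] [FiniteDimensional ℝ V₁]
    (ii : ℂ) (hii : ii ^ 2 = -1)
    (B₀ : LinearMap.BilinForm ℝ V₀) (hB₀ : B₀.IsAlt) (hB₀' : B₀.Nondegenerate)
    (B₁ : LinearMap.BilinForm ℝ V₁) (hB₁ : B₁.IsSymm) (hB₁' : B₁.Nondegenerate)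
    {r n : ℕ}
    (e : Module.Basis (Fin r × Fin 2) ℝ V₀) (he : SuperPfaffian.IsSymplecticBasis B₀ e)
    (b : Module.Basis (Fin n) ℝ V₁) (c : Fin n → ℂ)
    (hbc : SuperPfaffian.IsOddSymplecticBasis ii B₁ b c) :
    (∀ t : SuperPfaffian.SpoEven B₀ B₁ → ℂ, SuperPfaffian.IsTest t →
      ∀ ℓ : Module.Dual ℂ (SuperPfaffian.Values B₀ B₁),
        MeasureTheory.Integrable (SuperPfaffian.innerIntegral ii B₀ B₁ b c t ℓ) e.addHaar) ∧
    ∀ X : SuperPfaffian.SpoEven B₀ B₁,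
      SuperPfaffian.waveFrontAt ii (SuperPfaffian.Spf ii B₀ B₁ e b c) X ⊆
        Set.range (SuperPfaffian.moment B₀ B₁) \ {0} := by
  have hm := SuperPfaffian.continuous_moment (B₀ := B₀) (B₁ := B₁)
  have h0 := SuperPfaffian.eq_zero_of_moment_eq_zero (B₁ := B₁) hB₀ hB₀'
  have hF := SuperPfaffian.isAmplitude_berezin_expSoul (B₀ := B₀) (B₁ := B₁) ii b c
  refine ⟨fun t ht ℓ => ?_, fun X => ?_⟩
  · rw [funext (SuperPfaffian.innerIntegral_eq ii b c t ℓ)]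
    exact (hF ℓ).integrable_fourier hii hm SuperPfaffian.moment_smul h0 ht
  · refine SuperPfaffian.waveFrontAt_subset_range (μ := MeasureTheory.Measure.addHaar) (ν := e.addHaar)
      (m := SuperPfaffian.moment B₀ B₁)
      (K := ii ^ (((2 * r : ℤ) - (n : ℤ)) / 2) * (((2 * Real.pi : ℝ) : ℂ) ^ r)⁻¹) hii hF hm SuperPfaffian.moment_smul h0 (fun t ℓ => ?_) X
    rw [SuperPfaffian.Spf, funext (SuperPfaffian.innerIntegral_eq ii b c t ℓ)]
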